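/- For a finite group $G$ and an integer $a$ coprime to $|G|$, let $\rho_a$ be the permutation $g\mapsto g^a$ of the elements of $G$, and let $\operatorname{sgn}(\rho_a)\in\{1,-1\}$ be its signature. Let $f_2(G)=\{g\in G: g^2=1\}$, let $n_2(G)$ be the number of Sylow $2$-subgroups of $G$, let $\epsilon(G)=1$ if $|G|=2n_2(G)$ and $\epsilon(G)=0$ otherwise, and put $$d_G=(-1)^{\frac{|G|-|f_2(G)|}{2}}\,\frac{|G|^{|f_2(G)|}}{n_2(G)^{\epsilon(G)}}\in\mathbb Z .$$ Let $G$ be a finite group of order $2n$ with $n$ odd, in which every element of even order has order $2$. Then $$\operatorname{sgn}(\rho_a)=\left(\frac{d_G}{a}\right)$$ for every integer $a$ (positive or negative) with $\gcd(a,|G|)=1$, where $\left(\frac{\cdot}{\cdot}\right)$ is the Kronecker symbol. Moreover, $G$ has exactly one subgroup $H$ of index $2$; it has odd order $n$, and for every such $a$ the signature of $g\mapsto g^a$ on $G$ equals the signature of $h\mapsto h^a$ on $H$. -/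

import Mathlib

/-- The Kronecker symbol `(n / a)` of two integers. For `a ≠ 0` it is the product of
`(n / -1)` (only if `a < 0`), of `(n / 2) ^ v₂(a)`, and of the Jacobi symbol of `n` modulo the odd
part of `|a|`. Here `(n / -1)` is `-1` if `n < 0` and `1` otherwise, and `(n / 2)` is `0` for even
`n`, `1` for `n ≡ ±1 (mod 8)`, `-1` for `n ≡ ±3 (mod 8)`. -/
def kroneckerSym (n a : ℤ) : ℤ :=
  if a = 0 then (if n = 1 then 1 else 0)
  else (if a < 0 ∧ n < 0 then -1 else 1) *
    ZMod.χ₈ (n : ZMod 8) ^ padicValNat 2 a.natAbs *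
    jacobiSym n (a.natAbs / 2 ^ padicValNat 2 a.natAbs)

theorem zpow_bijective_of_isCoprime_card {G : Type*} [Group G] {a : ℤ}
    (h : IsCoprime a (Nat.card G : ℤ)) : Function.Bijective (fun g : G => g ^ a) := by
  obtain ⟨u, v, huv⟩ := h
  have key : ∀ g : G, g ^ (u * a) = g := fun g => by
    have h1 : g ^ (u * a + v * (Nat.card G : ℤ)) = g := by rw [huv, zpow_one]
    rwa [zpow_add, mul_comm v, zpow_mul g (Nat.card G : ℤ) v, zpow_natCast, pow_card_eq_one',
      one_zpow, mul_one] at h1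
  refine ⟨fun x y hxy => ?_, fun y => ⟨y ^ u, ?_⟩⟩
  · have hxy' : x ^ a = y ^ a := hxy
    rw [← key x, ← key y, mul_comm, zpow_mul, zpow_mul, hxy']
  · change (y ^ u) ^ a = y
    rw [← zpow_mul, key]

theorem IsCoprime.card_subgroup {G : Type*} [Group G] {a : ℤ}
    (h : IsCoprime a (Nat.card G : ℤ)) (H : Subgroup G) : IsCoprime a (Nat.card H : ℤ) :=
  h.of_isCoprime_of_dvd_right (Int.natCast_dvd_natCast.mpr H.card_subgroup_dvd_card)

/-- The permutation `ρ_a : g ↦ g ^ a` of the elements of `G`, for `a` coprime to `|G|`. -/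
noncomputable def powerPerm (G : Type*) [Group G] (a : ℤ)
    (h : IsCoprime a (Nat.card G : ℤ)) : Equiv.Perm G :=
  Equiv.ofBijective (fun g : G => g ^ a) (zpow_bijective_of_isCoprime_card h)

open Classical in
/-- The signature of the permutation `ρ_a` of the elements of the finite group `G`. -/
noncomputable def elSign (G : Type*) [Group G] [Finite G] (a : ℤ)
    (h : IsCoprime a (Nat.card G : ℤ)) : ℤˣ :=
  letI := Fintype.ofFinite G
  Equiv.Perm.sign (powerPerm G a h)

/-- `f_m(G) = {g ∈ G : g ^ m = 1}`. -/
def powEqOne (G : Type*) [Group G] (m : ℕ) : Set G := {g : G | g ^ m = 1}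

/-- The number `n₂(G)` of Sylow `2`-subgroups of `G`. -/
noncomputable def numSylowTwo (G : Type*) [Group G] : ℕ := Nat.card (Sylow 2 G)

/-- `ε(G)`, equal to `1` if `|G| = 2 n₂(G)` and to `0` otherwise. -/
noncomputable def epsG (G : Type*) [Group G] : ℕ :=
  if Nat.card G = 2 * numSylowTwo G then 1 else 0

/-- The integer `d_G = (-1) ^ ((|G| - |f₂(G)|) / 2) * |G| ^ |f₂(G)| / n₂(G) ^ ε(G)` of a finite
group `G`. The subtraction and both divisions are exact: elements outside `f₂(G)` come in pairs
`{g, g⁻¹}`, the identity lies in `f₂(G)`, and `n₂(G)` divides `|G|`. -/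
noncomputable def dG (G : Type*) [Group G] : ℤ :=
  (-1) ^ ((Nat.card G - (powEqOne G 2).ncard) / 2) *
    ((Nat.card G ^ (powEqOne G 2).ncard / numSylowTwo G ^ epsG G : ℕ) : ℤ)

/-!
A group element `t ∉ H` has even order, so it is an involution and is fixed by `ρ_a` for odd `a`;
hence `ρ_a` has the same signature on `G` as on `H`. Moreover `t` and `t h` are involutions for
every `h ∈ H`, so conjugation by `t` inverts `H`, and `H` is abelian.

On a nilpotent group of odd order `m`, the signature of `ρ_a` is the Jacobi symbol `(a / m)`. It is
multiplicative along a central extension, because translations of a group of odd order are even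
permutations and odd powers do not change a sign; this reduces the claim to the group `𝔽_p`. There
`u ↦ sgn(x ↦ u x)` is a nontrivial character of the cyclic group `𝔽_pˣ` with values in `{1, -1}`,
and the quadratic character is the only one (Zolotarev's lemma).

The involutions are the `n` elements outside `H`, and each of them generates its own Sylow
`2`-subgroup. So `d_G = (-1) ^ ((n - 1) / 2) * (2 n) ^ (n + 1) / n` is `n* = (-1) ^ ((n - 1) / 2) n`
times a square prime to `a`, and `(n* / a) = (a / n)` is quadratic reciprocity.
-/

/-- The integer `n* = (-1) ^ ((n - 1) / 2) * n` attached to an odd number `n`, for which quadratic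
reciprocity reads `(n* / m) = (m / n)`. The truncated quotient `n / 2` is `(n - 1) / 2`. -/
def quadraticStar (n : ℕ) : ℤ := (-1) ^ (n / 2) * n

section Kronecker

theorem odd_div_two_pow_padicValNat {m : ℕ} (hm : m ≠ 0) : Odd (m / 2 ^ padicValNat 2 m) := by
  rw [← Nat.factorization_def m Nat.prime_two, ← Nat.not_even_iff_odd, even_iff_two_dvd]
  exact Nat.not_dvd_ordCompl Nat.prime_two hm

theorem two_pow_padicValNat_mul_div (m : ℕ) :
    2 ^ padicValNat 2 m * (m / 2 ^ padicValNat 2 m) = m :=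
  Nat.mul_div_cancel' pow_padicValNat_dvd

variable {n : ℕ}

theorem natAbs_quadraticStar (n : ℕ) : (quadraticStar n).natAbs = n := by
  simp [quadraticStar, Int.natAbs_mul, Int.natAbs_pow]

theorem quadraticStar_neg_iff (hn : n ≠ 0) : quadraticStar n < 0 ↔ Odd (n / 2) := by
  rcases Nat.even_or_odd (n / 2) with h | h
  · simp [quadraticStar, h.neg_one_pow, Nat.not_odd_iff_even.2 h]
  · simp [quadraticStar, h.neg_one_pow, h, Nat.pos_of_ne_zero hn]

theorem quadraticStar_eq_one_iff : quadraticStar n = 1 ↔ n = 1 := by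
  refine ⟨fun h => ?_, fun h => by simp [h, quadraticStar]⟩
  rw [← natAbs_quadraticStar n, h, Int.natAbs_one]

theorem χ₈_quadraticStar (n : ℕ) : ZMod.χ₈ (quadraticStar n : ZMod 8) = ZMod.χ₈ n := by
  have hneg : ZMod.χ₈ (-1) = 1 := by decide
  simp only [quadraticStar, Int.cast_mul, Int.cast_pow, Int.cast_neg, Int.cast_one,
    Int.cast_natCast, map_mul, map_pow, hneg, one_pow, one_mul]

theorem jacobiSym_sign_eq (hn : Odd n) {a : ℤ} (ha : a ≠ 0) :
    jacobiSym a.sign n = if a < 0 ∧ quadraticStar n < 0 then -1 else 1 := by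
  simp only [quadraticStar_neg_iff hn.pos.ne']
  rcases ha.lt_or_gt with h | h
  · rw [Int.sign_eq_neg_one_of_neg h, jacobiSym.at_neg_one hn,
      ZMod.χ₄_eq_neg_one_pow (Nat.odd_iff.1 hn), neg_one_pow_eq_ite]
    simp [h, ← Nat.not_even_iff_odd]
  · simp [Int.sign_eq_one_of_pos h, h.not_gt]

theorem jacobiSym_quadraticStar {m : ℕ} (hm : Odd m) (hn : Odd n) :
    jacobiSym (quadraticStar n) m = jacobiSym m n := by
  rw [quadraticStar, jacobiSym.mul_left, jacobiSym.pow_left, jacobiSym.at_neg_one hm,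
    ZMod.χ₄_eq_neg_one_pow (Nat.odd_iff.1 hm), ← pow_mul, jacobiSym.quadratic_reciprocity hn hm,
    ← mul_assoc, ← pow_add, mul_comm (n / 2), Even.neg_one_pow (Even.add_self _), one_mul]

theorem kroneckerSym_quadraticStar (hn : Odd n) (a : ℤ) :
    kroneckerSym (quadraticStar n) a = jacobiSym a n := by
  rcases eq_or_ne a 0 with rfl | ha
  · simp only [kroneckerSym, if_true, quadraticStar_eq_one_iff]
    split_ifs with h
    · rw [h, jacobiSym.one_right]
    · exact (jacobiSym.zero_left (by have := hn.pos; omega)).symm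
  · set v := padicValNat 2 a.natAbs
    have hodd : Odd (a.natAbs / 2 ^ v) := odd_div_two_pow_padicValNat (Int.natAbs_ne_zero.2 ha)
    have hfac : a = a.sign * 2 ^ v * (a.natAbs / 2 ^ v : ℕ) := by
      conv_lhs => rw [← Int.sign_mul_natAbs a, ← two_pow_padicValNat_mul_div a.natAbs]
      push_cast
      ring
    rw [kroneckerSym, if_neg ha, ← jacobiSym_sign_eq hn ha, χ₈_quadraticStar,
      jacobiSym_quadraticStar hodd hn, ← jacobiSym.at_two hn, ← jacobiSym.pow_left,
      ← jacobiSym.mul_left, ← jacobiSym.mul_left, ← hfac]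

theorem χ₈_sq_of_odd {s : ℤ} (hs : Odd s) : ZMod.χ₈ (s : ZMod 8) ^ 2 = 1 := by
  rw [ZMod.χ₈_int_eq_if_mod_eight, if_neg (by rw [Int.odd_iff.1 hs]; decide)]
  split_ifs <;> rfl

theorem kroneckerSym_mul_sq (d : ℤ) {a s : ℤ} (hs : s ≠ 0) (has : IsCoprime a s) :
    kroneckerSym (d * s ^ 2) a = kroneckerSym d a := by
  rcases eq_or_ne a 0 with rfl | ha
  · rw [Int.isUnit_sq (isCoprime_zero_left.1 has), mul_one]
  have hsign : d * s ^ 2 < 0 ↔ d < 0 := by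
    have : 0 < s ^ 2 := by positivity
    exact ⟨fun h => neg_of_mul_neg_left h this.le, fun h => mul_neg_of_neg_of_pos h this⟩
  have hjac : jacobiSym (s ^ 2) (a.natAbs / 2 ^ padicValNat 2 a.natAbs) = 1 := by
    refine jacobiSym.sq_one'
      (Int.isCoprime_iff_gcd_eq_one.1 (has.symm.of_isCoprime_of_dvd_right ?_))
    rw [← Int.dvd_natAbs]
    exact_mod_cast Nat.div_dvd_of_dvd pow_padicValNat_dvd
  have htwo : ZMod.χ₈ ((s : ZMod 8) ^ 2) ^ padicValNat 2 a.natAbs = 1 := by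
    rcases eq_or_ne (padicValNat 2 a.natAbs) 0 with h | h
    · rw [h, pow_zero]
    · have h2 : (2 : ℤ) ∣ a :=
        Int.natCast_dvd.2 (dvd_of_one_le_padicValNat (Nat.one_le_iff_ne_zero.2 h))
      have hodd : Odd s := by
        rw [← Int.isCoprime_two_left]
        exact has.of_isCoprime_of_dvd_left h2
      rw [map_pow, χ₈_sq_of_odd hodd, one_pow]
  simp only [kroneckerSym, if_neg ha, hsign, Int.cast_mul, Int.cast_pow, map_mul, mul_pow,
    htwo, jacobiSym.mul_left, hjac, mul_one]

end Kronecker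

section SignedPermutations

theorem units_int_pow_of_odd (u : ℤˣ) {k : ℕ} (hk : Odd k) : u ^ k = u := by
  rw [Int.units_pow_eq_pow_mod_two, Nat.odd_iff.1 hk, pow_one]

theorem sign_mulLeft_of_odd_card {K : Type*} [Group K] [Fintype K] [DecidableEq K]
    (hK : Odd (Nat.card K)) (c : K) : Equiv.Perm.sign (Equiv.mulLeft c) = 1 := by
  rw [← units_int_pow_of_odd (Equiv.Perm.sign (Equiv.mulLeft c)) hK, ← map_pow,
    Equiv.pow_mulLeft, pow_card_eq_one', Equiv.mulLeft_one, Equiv.Perm.sign_one]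

theorem isCycle_mulLeft_of_generator {K : Type*} [Group K] {g : K}
    (hg : ∀ x, x ∈ Subgroup.zpowers g) (hg1 : g ≠ 1) : (Equiv.mulLeft g).IsCycle := by
  refine ⟨1, by simpa using hg1, fun y _ => ?_⟩
  obtain ⟨k, rfl⟩ := Subgroup.mem_zpowers_iff.1 (hg y)
  exact ⟨k, by simp [Equiv.zpow_mulLeft]⟩

theorem sign_mulLeft_of_generator {K : Type*} [Group K] [Fintype K] [DecidableEq K] {g : K}
    (hg : ∀ x, x ∈ Subgroup.zpowers g) (hK : Even (Nat.card K)) :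
    Equiv.Perm.sign (Equiv.mulLeft g) = -1 := by
  have hg1 : g ≠ 1 := by
    rintro rfl
    have : Nat.card K = 1 := by rw [← orderOf_eq_card_of_forall_mem_zpowers hg, orderOf_one]
    rw [this] at hK
    exact Nat.not_even_one hK
  have hsupp : (Equiv.mulLeft g).support = Finset.univ := by
    ext x
    simpa using hg1
  rw [(isCycle_mulLeft_of_generator hg hg1).sign, hsupp, Finset.card_univ,
    ← Nat.card_eq_fintype_card, hK.neg_one_pow]

theorem eq_of_ne_one_of_isCyclic {K : Type*} [Group K] [IsCyclic K] {φ ψ : K →* ℤˣ}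
    (hφ : φ ≠ 1) (hψ : ψ ≠ 1) : φ = ψ := by
  obtain ⟨g, hg⟩ := IsCyclic.exists_generator (α := K)
  have apply_generator : ∀ χ : K →* ℤˣ, χ ≠ 1 → χ g = -1 := fun χ hχ =>
    (Int.units_eq_one_or _).resolve_left fun h =>
      hχ ((MonoidHom.eq_iff_eq_on_generator hg χ 1).2 h)
  rw [MonoidHom.eq_iff_eq_on_generator hg, apply_generator φ hφ, apply_generator ψ hψ]

variable {F : Type*} [Field F] [Fintype F] [DecidableEq F]

theorem sign_toPerm_units_eq_sign_mulLeft (u : Fˣ) :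
    Equiv.Perm.sign (MulAction.toPerm u : Equiv.Perm F) = Equiv.Perm.sign (Equiv.mulLeft u) := by
  rw [← Equiv.Perm.sign_subtypePerm (p := (· ≠ 0)) (MulAction.toPerm u : Equiv.Perm F)
    (by simp [Units.smul_def]) (fun x hx h0 => hx (by simp [h0]))]
  exact (Equiv.Perm.sign_eq_sign_of_equiv _ _ unitsEquivNeZero fun _ => rfl).symm

theorem sign_toPerm_units_eq_quadraticChar (hF : ringChar F ≠ 2) (u : Fˣ) :
    Equiv.Perm.sign (MulAction.toPerm u : Equiv.Perm F) = (quadraticChar F).toUnitHom u := by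
  let φ : Fˣ →* ℤˣ := Equiv.Perm.sign.comp (MulAction.toPermHom Fˣ F)
  have hφ : φ ≠ 1 := by
    obtain ⟨g, hg⟩ := IsCyclic.exists_generator (α := Fˣ)
    have heven : Even (Nat.card Fˣ) := by
      rw [Nat.card_units, Nat.card_eq_fintype_card]
      exact Nat.Odd.sub_odd (Nat.odd_iff.2 (FiniteField.odd_card_of_char_ne_two hF)) odd_one
    have hφg : φ g = -1 :=
      (sign_toPerm_units_eq_sign_mulLeft g).trans (sign_mulLeft_of_generator hg heven)
    intro h
    rw [h] at hφg
    exact absurd hφg (by simp)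
  have hχ : (quadraticChar F).toUnitHom ≠ 1 := fun h =>
    quadraticChar_ne_one hF (MulChar.ext fun x => by
      rw [← MulChar.coe_toUnitHom, h, MulChar.one_apply_coe, MonoidHom.one_apply, Units.val_one])
  exact DFunLike.congr_fun (eq_of_ne_one_of_isCyclic hφ hχ) u

end SignedPermutations

section PowerSign

variable {G : Type*} [Group G] {a : ℤ}

theorem isCoprime_card_quotient (h : IsCoprime a (Nat.card G : ℤ)) (K : Subgroup G) :
    IsCoprime a (Nat.card (G ⧸ K) : ℤ) :=
  h.of_isCoprime_of_dvd_right (Int.natCast_dvd_natCast.2 K.card_quotient_dvd_card)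

theorem elSign_eq_sign_of_equiv [Finite G] {α : Type*} [Fintype α] [DecidableEq α]
    (ha : IsCoprime a (Nat.card G : ℤ)) (e : α ≃ G) (σ : Equiv.Perm α)
    (h : ∀ x, e (σ x) = e x ^ a) : elSign G a ha = Equiv.Perm.sign σ := by
  classical
  let := Fintype.ofFinite G
  exact (Equiv.Perm.sign_eq_sign_of_equiv _ _ e h).symm

theorem elSign_eq_sign [Fintype G] [DecidableEq G] (ha : IsCoprime a (Nat.card G : ℤ)) :
    elSign G a ha = Equiv.Perm.sign (powerPerm G a ha) :=
  elSign_eq_sign_of_equiv ha (Equiv.refl G) _ fun _ => rfl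

/-- The bijection `(q, k) ↦ s(q) k` given by the set-theoretic section `s = Quotient.out` of the
projection `G → G ⧸ K`; it makes a power map of `G` a permutation of `(G ⧸ K) × K`. -/
noncomputable def quotientProdEquiv (K : Subgroup G) : (G ⧸ K) × K ≃ G where
  toFun x := x.1.out * x.2
  invFun g := ((g : G ⧸ K), ⟨(g : G ⧸ K).out⁻¹ * g, QuotientGroup.eq.1 (by simp)⟩)
  left_inv := fun ⟨q, k⟩ => by
    have hq : ((q.out * k : G) : G ⧸ K) = q := by
      rw [QuotientGroup.mk_mul_of_mem _ k.2, QuotientGroup.out_eq']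
    exact Prod.ext hq (Subtype.ext (by simp [hq]))
  right_inv g := by simp

theorem elSign_eq_mul_quotient [Finite G] (hG : Odd (Nat.card G)) {K : Subgroup G} [K.Normal]
    (hK : K ≤ Subgroup.center G) (ha : IsCoprime a (Nat.card G : ℤ)) :
    elSign G a ha =
      elSign K a (ha.card_subgroup K) * elSign (G ⧸ K) a (isCoprime_card_quotient ha K) := by
  classical
  let := Fintype.ofFinite K
  let := Fintype.ofFinite (G ⧸ K)
  obtain ⟨hQodd, hKodd⟩ : Odd (Nat.card (G ⧸ K)) ∧ Odd (Nat.card K) := by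
    rwa [← Nat.odd_mul, ← K.card_eq_card_quotient_mul_card_subgroup]
  -- As `k` is central, `(s(q) k) ^ a = s(q) ^ a * k ^ a = s(q ^ a) * (c(q) * k ^ a)`: on the fibre
  -- over `q` the power map is that of `K` followed by a translation, which is an even permutation.
  let ρQ := powerPerm (G ⧸ K) a (isCoprime_card_quotient ha K)
  let ρK := powerPerm K a (ha.card_subgroup K)
  let c : G ⧸ K → K := fun q => ⟨(q ^ a).out⁻¹ * q.out ^ a, QuotientGroup.eq.1 (by simp)⟩
  let σ : Equiv.Perm ((G ⧸ K) × K) :=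
    Equiv.prodCongrLeft (fun _ => ρQ) * Equiv.prodCongrRight fun q => Equiv.mulLeft (c q) * ρK
  have hσ : ∀ x, quotientProdEquiv K (σ x) = quotientProdEquiv K x ^ a := fun ⟨q, k⟩ => by
    have hcomm : Commute q.out (k : G) := Subgroup.mem_center_iff.1 (hK k.2) q.out
    change (q ^ a).out * ((q ^ a).out⁻¹ * q.out ^ a * k ^ a) = (q.out * k) ^ a
    rw [hcomm.mul_zpow, mul_assoc, mul_inv_cancel_left]
  have hfibre : ∀ q, Equiv.Perm.sign (Equiv.mulLeft (c q) * ρK) = Equiv.Perm.sign ρK := fun q => by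
    rw [Equiv.Perm.sign_mul, sign_mulLeft_of_odd_card hKodd, one_mul]
  rw [elSign_eq_sign_of_equiv ha _ σ hσ, elSign_eq_sign, elSign_eq_sign, Equiv.Perm.sign_mul,
    Equiv.Perm.sign_prodCongrLeft, Equiv.Perm.sign_prodCongrRight]
  simp only [hfibre, Finset.prod_const, Finset.card_univ, ← Nat.card_eq_fintype_card,
    units_int_pow_of_odd _ hQodd, units_int_pow_of_odd _ hKodd]
  exact mul_comm _ _

theorem elSign_of_card_eq_one [Finite G] (hG : Nat.card G = 1) (ha : IsCoprime a (Nat.card G : ℤ)) :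
    elSign G a ha = 1 := by
  classical
  let := Fintype.ofFinite G
  have : Subsingleton G := (Nat.card_eq_one_iff_unique.1 hG).1
  rw [elSign_eq_sign, Subsingleton.elim (powerPerm G a ha) 1, Equiv.Perm.sign_one]

theorem elSign_of_card_prime [Finite G] (hprime : (Nat.card G).Prime) (hodd : Odd (Nat.card G))
    (ha : IsCoprime a (Nat.card G : ℤ)) : (elSign G a ha : ℤ) = jacobiSym a (Nat.card G) := by
  have := Fact.mk hprime
  have hcyc : IsCyclic G := isCyclic_of_prime_card rfl
  have hchar : ringChar (ZMod (Nat.card G)) ≠ 2 := by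
    rw [ZMod.ringChar_zmod_n]
    exact hodd.ne_two_of_dvd_nat dvd_rfl
  have ha' : IsUnit (a : ZMod (Nat.card G)) := by
    rwa [ZMod.coe_int_isUnit_iff_isCoprime, isCoprime_comm]
  let e : ZMod (Nat.card G) ≃ G := Multiplicative.ofAdd.trans (zmodCyclicMulEquiv hcyc).toEquiv
  have he : ∀ x, e (MulAction.toPerm ha'.unit x) = e x ^ a := fun x => by
    simp [e, Units.smul_def, ← zsmul_eq_mul]
  rw [elSign_eq_sign_of_equiv ha e _ he, sign_toPerm_units_eq_quadraticChar hchar,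
    MulChar.coe_toUnitHom, IsUnit.unit_spec, ← jacobiSym.legendreSym.to_jacobiSym, legendreSym]

theorem normal_of_le_center {K : Subgroup G} (hK : K ≤ Subgroup.center G) : K.Normal where
  conj_mem k hk g := by rwa [Subgroup.mem_center_iff.1 (hK hk) g, mul_inv_cancel_right]

theorem exists_le_center_card_prime (G : Type*) [Group G] [Finite G] [Group.IsNilpotent G]
    [Nontrivial G] : ∃ K ≤ Subgroup.center G, (Nat.card K).Prime := by
  have hcard : Nat.card (Subgroup.center G) ≠ 1 :=
    Subgroup.card_eq_one.not.2 (Group.IsNilpotent.center_ne_bot G)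
  have := Fact.mk (Nat.minFac_prime hcard)
  obtain ⟨z, hz⟩ := exists_prime_orderOf_dvd_card' _ (Nat.minFac_dvd (Nat.card (Subgroup.center G)))
  refine ⟨Subgroup.zpowers (z : G), Subgroup.zpowers_le.2 z.2, ?_⟩
  rw [Nat.card_zpowers, Subgroup.orderOf_coe, hz]
  exact Nat.minFac_prime hcard

theorem elSign_eq_jacobiSym [Finite G] [Group.IsNilpotent G] (hG : Odd (Nat.card G))
    (ha : IsCoprime a (Nat.card G : ℤ)) : (elSign G a ha : ℤ) = jacobiSym a (Nat.card G) := by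
  induction hm : Nat.card G using Nat.strong_induction_on generalizing G with
  | _ m ih =>
  subst hm
  rcases subsingleton_or_nontrivial G with hsub | hnontriv
  · have h1 : Nat.card G = 1 := Nat.card_eq_one_iff_unique.2 ⟨hsub, inferInstance⟩
    rw [elSign_of_card_eq_one h1 ha, h1, jacobiSym.one_right, Units.val_one]
  · obtain ⟨K, hK, hKprime⟩ := exists_le_center_card_prime G
    have := normal_of_le_center hK
    have hcard := K.card_eq_card_quotient_mul_card_subgroup
    obtain ⟨hQodd, hKodd⟩ := Nat.odd_mul.1 (hcard ▸ hG)
    have hlt : Nat.card (G ⧸ K) < Nat.card G :=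
      hcard ▸ lt_mul_of_one_lt_right Nat.card_pos hKprime.one_lt
    rw [elSign_eq_mul_quotient hG hK ha, Units.val_mul, elSign_of_card_prime hKprime hKodd,
      ih _ hlt hQodd _ rfl, hcard, jacobiSym.mul_right' a Nat.card_pos.ne' hKprime.ne_zero,
      mul_comm]

end PowerSign

section Involutions

variable {G : Type*} [Group G] {H : Subgroup G}

theorem zpow_eq_self_of_sq_eq_one {t : G} (ht : t ^ 2 = 1) {a : ℤ} (ha : Odd a) : t ^ a = t := by
  obtain ⟨k, rfl⟩ := ha
  rw [zpow_add_one, zpow_mul, zpow_ofNat, ht, one_zpow, one_mul]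

theorem elSign_eq_elSign_subgroup [Finite G] (hinv : ∀ t ∉ H, t ^ 2 = 1) {a : ℤ} (hodd : Odd a)
    (ha : IsCoprime a (Nat.card G : ℤ)) : elSign G a ha = elSign H a (ha.card_subgroup H) := by
  classical
  let := Fintype.ofFinite G
  have hfix : ∀ t ∉ H, powerPerm G a ha t = t := fun t ht =>
    zpow_eq_self_of_sq_eq_one (hinv t ht) hodd
  have hmem : ∀ x, powerPerm G a ha x ∈ H ↔ x ∈ H := fun x =>
    ⟨fun h => by_contra fun hx => hx (hfix x hx ▸ h), fun h => H.zpow_mem h a⟩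
  rw [elSign_eq_sign, ← Equiv.Perm.sign_subtypePerm (powerPerm G a ha) hmem fun x =>
    not_imp_comm.1 (hfix x)]
  exact (elSign_eq_sign_of_equiv _ (Equiv.refl H) _ fun _ => rfl).symm

theorem isMulCommutative_of_sq_eq_one_of_notMem (hH : H ≠ ⊤) (hinv : ∀ t ∉ H, t ^ 2 = 1) :
    IsMulCommutative H := by
  obtain ⟨t, ht⟩ : ∃ t, t ∉ H := by
    simpa [Subgroup.eq_top_iff'] using hH
  have conj_eq_inv : ∀ h ∈ H, t * h * t⁻¹ = h⁻¹ := fun h hh => by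
    have hsq := hinv (t * h) fun hth => ht ((H.mul_mem_cancel_right hh).1 hth)
    rw [inv_eq_of_mul_eq_one_left ((sq t).symm.trans (hinv t ht))]
    exact eq_inv_of_mul_eq_one_left (by rw [← hsq, sq, mul_assoc (t * h)])
  refine ⟨⟨fun x y => Subtype.ext (inv_injective ?_)⟩⟩
  calc (x * y : G)⁻¹ = t * (x * y) * t⁻¹ := (conj_eq_inv _ (H.mul_mem x.2 y.2)).symm
    _ = (t * x * t⁻¹) * (t * y * t⁻¹) := by group
    _ = (x : G)⁻¹ * (y : G)⁻¹ := by rw [conj_eq_inv _ x.2, conj_eq_inv _ y.2]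
    _ = (y * x : G)⁻¹ := (mul_inv_rev _ _).symm

theorem elSign_eq_jacobiSym_of_sq_eq_one_of_notMem [Finite G] (hH : H ≠ ⊤)
    (hinv : ∀ t ∉ H, t ^ 2 = 1) (hHodd : Odd (Nat.card H)) {a : ℤ} (hodd : Odd a)
    (ha : IsCoprime a (Nat.card G : ℤ)) :
    (elSign G a ha : ℤ) = jacobiSym a (Nat.card H) := by
  have := isMulCommutative_of_sq_eq_one_of_notMem hH hinv
  let : CommGroup H := { mul_comm := mul_comm' }
  have : Group.IsNilpotent H := CommGroup.isNilpotent
  rw [elSign_eq_elSign_subgroup hinv hodd ha, elSign_eq_jacobiSym hHodd]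

theorem mem_iff_odd_orderOf_of_index_eq_two (hH : H.index = 2) (hodd : Odd (Nat.card H)) {g : G} :
    g ∈ H ↔ Odd (orderOf g) := by
  refine ⟨fun hg => hodd.of_dvd_nat (H.orderOf_dvd_natCard hg), fun ⟨k, hk⟩ => ?_⟩
  have hg : g = (g ^ 2) ^ (k + 1) := by
    rw [← pow_mul, show 2 * (k + 1) = orderOf g + 1 by omega, pow_succ, pow_orderOf_eq_one,
      one_mul]
  rw [hg]
  exact H.pow_mem (Subgroup.sq_mem_of_index_two hH g) _

theorem card_eq_of_index_eq_two {n : ℕ} (hcard : Nat.card G = 2 * n) (hH : H.index = 2) :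
    Nat.card H = n := by
  have := H.card_mul_index
  rw [hH, hcard] at this
  omega

theorem setOf_orderOf_eq_two_eq_compl (hH : H.index = 2) (hodd : Odd (Nat.card H))
    (hinv : ∀ t ∉ H, t ^ 2 = 1) : {g : G | orderOf g = 2} = (H : Set G)ᶜ := by
  ext g
  refine ⟨fun (hg : orderOf g = 2) hgH => ?_,
    fun hg => orderOf_eq_prime (hinv g hg) fun h1 => hg (h1 ▸ H.one_mem)⟩
  have := (mem_iff_odd_orderOf_of_index_eq_two hH hodd).1 hgH
  rw [hg] at this
  exact absurd this (by decide)

theorem ncard_compl_of_index_eq_two [Finite G] (hH : H.index = 2) :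
    ((H : Set G)ᶜ).ncard = Nat.card H := by
  have hadd : Nat.card H + ((H : Set G)ᶜ).ncard = Nat.card G :=
    Set.ncard_add_ncard_compl (H : Set G)
  have hmul := H.card_mul_index
  rw [hH] at hmul
  omega

theorem powEqOne_two_eq_insert (G : Type*) [Group G] :
    powEqOne G 2 = insert 1 {g | orderOf g = 2} := by
  ext g
  change g ^ 2 = 1 ↔ g = 1 ∨ orderOf g = 2
  rw [← orderOf_dvd_iff_pow_eq_one, Nat.dvd_prime Nat.prime_two, orderOf_eq_one_iff]

theorem ncard_powEqOne_two (G : Type*) [Group G] [Finite G] :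
    (powEqOne G 2).ncard = {g : G | orderOf g = 2}.ncard + 1 := by
  rw [powEqOne_two_eq_insert, Set.ncard_insert_of_notMem (by simp)]

end Involutions

section TwiceOdd

variable {G : Type*} [Group G] [Finite G] {n : ℕ}

theorem card_sylow_two_eq_two (hn : Odd n) (hcard : Nat.card G = 2 * n) (P : Sylow 2 G) :
    Nat.card P = 2 := by
  rw [P.card_eq_multiplicity, hcard, Nat.factorization_mul two_ne_zero hn.pos.ne',
    Finsupp.add_apply, Nat.prime_two.factorization_self,
    Nat.factorization_eq_zero_of_not_dvd hn.not_two_dvd_nat, add_zero, pow_one]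

theorem existsUnique_index_eq_two (hn : Odd n) (hcard : Nat.card G = 2 * n) :
    ∃! H : Subgroup G, H.index = 2 := by
  refine existsUnique_of_exists_of_unique ?_ fun H K hH hK => ?_
  · have := Fact.mk Nat.prime_two
    obtain ⟨P⟩ : Nonempty (Sylow 2 G) := inferInstance
    have hP := card_sylow_two_eq_two hn hcard P
    have hcyc : IsCyclic P := isCyclic_of_prime_card hP
    have hmin : (Nat.card G).minFac = 2 := by
      rw [Nat.minFac_eq_two_iff, hcard]
      exact dvd_mul_right 2 n
    exact ⟨_, (hcyc.isComplement' hmin).symm.index_eq_card.trans hP⟩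
  · ext g
    rw [mem_iff_odd_orderOf_of_index_eq_two hH (card_eq_of_index_eq_two hcard hH ▸ hn),
      mem_iff_odd_orderOf_of_index_eq_two hK (card_eq_of_index_eq_two hcard hK ▸ hn)]

theorem numSylowTwo_eq_ncard_orderOf_eq_two (card_eq : ∀ P : Sylow 2 G, Nat.card P = 2) :
    numSylowTwo G = {g : G | orderOf g = 2}.ncard := by
  have := Fact.mk Nat.prime_two
  obtain ⟨P₀⟩ : Nonempty (Sylow 2 G) := inferInstance
  let f : {g : G | orderOf g = 2} → Sylow 2 G := fun t =>
    Sylow.ofCard (Subgroup.zpowers (t : G)) (by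
      rw [← P₀.card_eq_multiplicity, card_eq, Nat.card_zpowers, t.2])
  have mem_iff : ∀ t P, f t = P ↔ (t : G) ∈ P := fun t P => by
    refine ⟨fun h => h ▸ Subgroup.mem_zpowers (t : G), fun h => Sylow.ext ?_⟩
    refine Subgroup.eq_of_le_of_card_ge (Subgroup.zpowers_le.2 h) ?_
    exact (card_eq P).trans_le (card_eq (f t)).ge
  have hf : Function.Bijective f := (Function.bijective_iff_existsUnique f).2 fun P => by
    obtain ⟨y, hy, huniq⟩ := (Nat.card_eq_two_iff' (1 : P)).1 (card_eq P)
    have hy2 : orderOf (y : G) = 2 := by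
      rw [Subgroup.orderOf_coe]
      exact orderOf_eq_prime
        (orderOf_dvd_iff_pow_eq_one.1 ((orderOf_dvd_natCard y).trans (card_eq P).dvd)) hy
    refine ⟨⟨y, hy2⟩, (mem_iff _ P).2 y.2, fun t ht => Subtype.ext ?_⟩
    have ht1 : (⟨t, (mem_iff t P).1 ht⟩ : P) ≠ 1 := fun h1 => by
      have h2 : orderOf (t : G) = 2 := t.2
      rw [show (t : G) = 1 from congrArg Subtype.val h1, orderOf_one] at h2
      exact absurd h2 (by decide)
    exact congrArg (Subtype.val : P → G) (huniq _ ht1)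
  rw [numSylowTwo, ← Nat.card_eq_of_bijective f hf, Nat.card_coe_set_eq]

theorem dG_eq (hn : Odd n) (hcard : Nat.card G = 2 * n)
    (hinvol : {g : G | orderOf g = 2}.ncard = n) :
    dG G = quadraticStar n * (2 ^ (n / 2 + 1) * n ^ (n / 2)) ^ 2 := by
  have hpow : (powEqOne G 2).ncard = n + 1 := by rw [ncard_powEqOne_two, hinvol]
  have hsylow : numSylowTwo G = n :=
    (numSylowTwo_eq_ncard_orderOf_eq_two (card_sylow_two_eq_two hn hcard)).trans hinvol
  have heps : epsG G = 1 := if_pos (by rw [hsylow, hcard])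
  have hdiv : (2 * n) ^ (n + 1) / n ^ 1 = n * (2 ^ (n / 2 + 1) * n ^ (n / 2)) ^ 2 := by
    refine Nat.div_eq_of_eq_mul_left (pow_pos hn.pos 1) ?_
    obtain ⟨k, hk⟩ := hn
    rw [show n / 2 = k by omega, show n + 1 = 2 * (k + 1) by omega, mul_pow 2, hk]
    ring
  have hexp : (2 * n - (n + 1)) / 2 = n / 2 := by
    obtain ⟨k, hk⟩ := hn
    omega
  rw [dG, hcard, hpow, hsylow, heps, hdiv, hexp, quadraticStar]
  push_cast
  ring

theorem kroneckerSym_dG (hn : Odd n) (hcard : Nat.card G = 2 * n)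
    (hinvol : {g : G | orderOf g = 2}.ncard = n) {a : ℤ} (ha : IsCoprime a (Nat.card G : ℤ)) :
    kroneckerSym (dG G) a = jacobiSym a n := by
  rw [hcard, Nat.cast_mul] at ha
  have hn0 : (n : ℤ) ≠ 0 := Int.natCast_ne_zero.2 hn.pos.ne'
  have hs : IsCoprime a (2 ^ (n / 2 + 1) * n ^ (n / 2)) :=
    ha.of_mul_right_left.pow_right.mul_right ha.of_mul_right_right.pow_right
  rw [dG_eq hn hcard hinvol, kroneckerSym_mul_sq _ (by positivity) hs,
    kroneckerSym_quadraticStar hn]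

end TwiceOdd

theorem mainTheorem7 {G : Type*} [Group G] [Finite G] (n : ℕ) (hn : Odd n)
    (hcard : Nat.card G = 2 * n)
    (hinv : ∀ g : G, Even (orderOf g) → orderOf g = 2) :
    (∀ (a : ℤ) (ha : IsCoprime a (Nat.card G : ℤ)),
      ((elSign G a ha : ℤˣ) : ℤ) = kroneckerSym (dG G) a) ∧
    (∃! H : Subgroup G, H.index = 2) ∧
    ∀ H : Subgroup G, H.index = 2 → Nat.card H = n ∧
      ∀ (a : ℤ) (ha : IsCoprime a (Nat.card G : ℤ)),
        elSign G a ha = elSign H a (ha.card_subgroup H) := by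
  have hex := existsUnique_index_eq_two hn hcard
  have hHcard : ∀ {H : Subgroup G}, H.index = 2 → Nat.card H = n := card_eq_of_index_eq_two hcard
  have hsq : ∀ {H : Subgroup G}, H.index = 2 → ∀ t ∉ H, t ^ 2 = 1 := fun hH t ht => by
    rw [mem_iff_odd_orderOf_of_index_eq_two hH (hHcard hH ▸ hn), Nat.not_odd_iff_even] at ht
    rw [← hinv t ht, pow_orderOf_eq_one]
  have hodd : ∀ {a : ℤ}, IsCoprime a (Nat.card G : ℤ) → Odd a := fun ha => by
    rw [hcard, Nat.cast_mul] at ha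
    exact Int.isCoprime_two_right.1 ha.of_mul_right_left
  refine ⟨fun a ha => ?_, hex, fun H hH =>
    ⟨hHcard hH, fun a ha => elSign_eq_elSign_subgroup (hsq hH) (hodd ha) ha⟩⟩
  obtain ⟨H, hH, -⟩ := hex
  have hHtop : H ≠ ⊤ := fun h => by simp [h] at hH
  have hinvol : {g : G | orderOf g = 2}.ncard = n := by
    rw [setOf_orderOf_eq_two_eq_compl hH (hHcard hH ▸ hn) (hsq hH),
      ncard_compl_of_index_eq_two hH, hHcard hH]
  rw [elSign_eq_jacobiSym_of_sq_eq_one_of_notMem hHtop (hsq hH) (hHcard hH ▸ hn) (hodd ha),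
    kroneckerSym_dG hn hcard hinvol ha, hHcard hH]
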